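/- Let $n\ge 1$, let $\Omega\subset\mathbb R^n$ be a non-empty, open, bounded, connected set with $C^1$ boundary, and let $T>0$. Let $c:\mathbb R^n\to\mathbb R$ satisfy $c\in C^1(\overline\Omega)$, $0<c_{\min}\le c\le c_{\max}$ on $\overline\Omega$ and $c=1$ on $\mathbb R^n\setminus\overline\Omega$. Let $h\in C^\infty((0,T)\times\partial\Omega)$, that is, $h$ is the restriction of a $C^\infty$ function defined on an open neighbourhood of $(0,T)\times\partial\Omega$ in $\mathbb R\times\mathbb R^n$. Let $H_0^1(\mathbb R^n)$ be the closure of the compactly supported $C^1$ functions with respect to $\int_{\mathbb R^n}\nabla\phi_1\cdot\nabla\phi_2\,dx$, and let $V=\{u\in H_0^1(\mathbb R^n): u|_\Omega\in H^1(\Omega)\}$ with the inner product $\int_\Omega \phi_1\phi_2\,dx+\int_{\mathbb R^n}\nabla\phi_1\cdot\nabla\phi_2\,dx$. Thus $V$ is the Hilbert space obtained as the closure of the compactly supported $C^1$ functions in the corresponding norm; an element $u$ is determined by $(u|_\Omega,\nabla u)\in L^2(\Omega)\times L^2(\mathbb R^n;\mathbb R^n)$. Let $V'$ be the dual of $V$,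 let $\gamma:V\to L^2(\partial\Omega)$ be the trace operator, and let $dS$ be the surface measure on $\partial\Omega$. Consider the backward transmission problem $$\tfrac1{c^2}z''-\Delta z=0\ \text{ in }(\mathbb R^n\setminus\partial\Omega)\times(0,T),\qquad z(T)=z'(T)=0\ \text{ in }\mathbb R^n,\qquad [z]=0,\ \Big[\tfrac{\partial z}{\partial \mathbf n}\Big]=h\ \text{ on }\partial\Omega\times(0,T),$$ where $[\,\cdot\,]$ is the exterior minus the interior value on $\partial\Omega$ and $\mathbf n$ is the outward unit normal. A weak solution is a $z\in L^2(0,T;V)$ such that: 1. $z\in H^1(0,T;L^2(\mathbb R^n))$, with weak time derivative $z'\in L^2(0,T;L^2(\mathbb R^n))$; 2. $c^{-2}z'$ has a weak time derivative $c^{-2}z''\in L^2(0,T;V')$, meaning that for every $w\in V\cap L^2(\mathbb R^n)$ the weak derivative on $(0,T)$ of $t\mapsto\int_{\mathbb R^n}c^{-2}z'(t)\,w\,dx$ is $t\mapsto\langle c^{-2}z''(t),w\rangle$; 3. $z(T)=0$ in the sense that $z$ has a continuous representative $[0,T]\to L^2(\mathbb R^n)$ vanishing at $T$, and $z'(T)=0$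 in the sense that for every $w\in V\cap L^2(\mathbb R^n)$ the function $t\mapsto\int_{\mathbb R^n}c^{-2}z'(t)\,w\,dx$ has a continuous representative on $[0,T]$ vanishing at $T$; 4. for all $v\in L^2(0,T;V)$, the function $t\mapsto\int_{\partial\Omega}h(t)\,\gamma v(t)\,dS$ is integrable on $(0,T)$ and $$\int_0^T\langle c^{-2}z''(t),v(t)\rangle\,dt+\int_0^T\int_{\mathbb R^n}\nabla z(t)\cdot\nabla v(t)\,dx\,dt=-\int_0^T\int_{\partial\Omega}h(t)\,\gamma v(t)\,dS\,dt .$$ Theorem. The weak solution is unique in $L^2(0,T;V)$: if $z_1,z_2\in L^2(0,T;V)$ are two weak solutions for the same $h$, then $z_1=z_2$. -/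

import Mathlib

open MeasureTheory Set Filter Topology
open scoped ContDiff

noncomputable section

namespace WaveTransmission

/-- The Euclidean space `ℝⁿ`. -/
abbrev Rn (n : ℕ) : Type := EuclideanSpace ℝ (Fin n)

/-- `Ω` has `C¹` boundary: near each boundary point, `Ω` is the sublevel set `{ρ < 0}` of a
`C¹` function `ρ` without critical points. -/
def HasC1Boundary {n : ℕ} (Ω : Set (Rn n)) : Prop :=
  ∀ p ∈ frontier Ω, ∃ (U : Set (Rn n)) (ρ : Rn n → ℝ), IsOpen U ∧ p ∈ U ∧
    ContDiffOn ℝ 1 ρ U ∧ (∀ x ∈ U, gradient ρ x ≠ 0) ∧ Ω ∩ U = {x ∈ U | ρ x < 0}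

/-- `c ∈ C¹(Ω̄)` for an open set `Ω`: `c` is continuous on `Ω̄`, continuously differentiable
in `Ω`, and its gradient extends continuously to `Ω̄`. -/
def IsC1UpToBoundary {n : ℕ} (Ω : Set (Rn n)) (c : Rn n → ℝ) : Prop :=
  ContinuousOn c (closure Ω) ∧ ContDiffOn ℝ 1 c Ω ∧
    ∃ D : Rn n → Rn n, ContinuousOn D (closure Ω) ∧ ∀ x ∈ Ω, D x = gradient c x

/-- The surface measure `dS` on `∂Ω`: the `(n-1)`-dimensional Hausdorff measure, normalised so as
to agree with Lebesgue measure on `ℝⁿ⁻¹`, restricted to `∂Ω`. -/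
def surfaceMeasure {n : ℕ} (Ω : Set (Rn n)) : Measure (Rn n) :=
  (Measure.euclideanHausdorffMeasure (n - 1)).restrict (frontier Ω)

/-- `h ∈ C^∞((0,T) × ∂Ω)`: `h` is the restriction to `(0,T) × ∂Ω` of a smooth function on an open
neighbourhood of that set. -/
def SmoothOnLateral {n : ℕ} (T : ℝ) (Ω : Set (Rn n)) (h : ℝ → Rn n → ℝ) : Prop :=
  ∃ (U : Set (ℝ × Rn n)) (H : ℝ × Rn n → ℝ), IsOpen U ∧ Ioo 0 T ×ˢ frontier Ω ⊆ U ∧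
    ContDiffOn ℝ ∞ H U ∧ ∀ t ∈ Ioo 0 T, ∀ x ∈ frontier Ω, h t x = H (t, x)

/-- The Hilbert space `L²(ℝⁿ)`. -/
abbrev L2Rn (n : ℕ) : Type := Lp ℝ 2 (volume : Measure (Rn n))

/-- The Hilbert space `L²(Ω) × L²(ℝⁿ; ℝⁿ)`, in which `V` is embedded by `u ↦ (u|_Ω, ∇u)`. -/
abbrev PairSpace {n : ℕ} (Ω : Set (Rn n)) : Type :=
  WithLp 2 (Lp ℝ 2 ((volume : Measure (Rn n)).restrict Ω) ×
    Lp (Rn n) 2 (volume : Measure (Rn n)))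

/-- `V` as a closed subspace of the pair space: the closure of the space of all
`(φ|_Ω, ∇φ)` with `φ` a compactly supported `C¹` function on `ℝⁿ` (these pairs already form a
linear subspace). -/
def VSubmodule {n : ℕ} (Ω : Set (Rn n)) : Submodule ℝ (PairSpace Ω) :=
  (Submodule.span ℝ {p : PairSpace Ω | ∃ φ : Rn n → ℝ, ContDiff ℝ 1 φ ∧ HasCompactSupport φ ∧
    p.fst =ᵐ[volume.restrict Ω] φ ∧ p.snd =ᵐ[volume] gradient φ}).topologicalClosure

/-- The Hilbert space `V = {u ∈ H₀¹(ℝⁿ) : u|_Ω ∈ H¹(Ω)}`, where `H₀¹(ℝⁿ)` is the closure of the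
compactly supported differentiable functions with respect to the Dirichlet inner product
`∫ ∇φ₁·∇φ₂`. The inner product of `V` is `∫_Ω φ₁ φ₂ + ∫_{ℝⁿ} ∇φ₁·∇φ₂`. A function `u ∈ V` is
determined by the pair `(u|_Ω, ∇u)`, and is modelled by it. -/
abbrev V {n : ℕ} (Ω : Set (Rn n)) : Type := VSubmodule Ω

/-- The restriction `u|_Ω ∈ L²(Ω)` of `u ∈ V`. -/
def V.onDomain {n : ℕ} {Ω : Set (Rn n)} (u : V Ω) : Lp ℝ 2 ((volume : Measure (Rn n)).restrict Ω) :=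
  (u : PairSpace Ω).fst

/-- The weak gradient `∇u ∈ L²(ℝⁿ; ℝⁿ)` of `u ∈ V`. -/
def V.grad {n : ℕ} {Ω : Set (Rn n)} (u : V Ω) : Lp (Rn n) 2 (volume : Measure (Rn n)) :=
  (u : PairSpace Ω).snd

/-- `G` is the weak gradient of `f` on `ℝⁿ`. -/
def HasWeakGradient {n : ℕ} (f : Rn n → ℝ) (G : Rn n → Rn n) : Prop :=
  ∀ ψ : Rn n → ℝ, ContDiff ℝ ∞ ψ → HasCompactSupport ψ →
    ∫ x, f x • gradient ψ x = - ∫ x, ψ x • G x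

/-- The element `u` of `V` is, as a function on `ℝⁿ`, the square integrable function `f`. -/
def V.IsFunction {n : ℕ} {Ω : Set (Rn n)} (u : V Ω) (f : L2Rn n) : Prop :=
  u.onDomain =ᵐ[volume.restrict Ω] f ∧ HasWeakGradient f u.grad

/-- `g ∈ L²(∂Ω)` is the trace of `u|_Ω ∈ H¹(Ω)`: it is the limit in `L²(∂Ω)` of the restrictions
to `∂Ω` of `C¹` functions on `ℝⁿ` that converge to `u` in `H¹(Ω)`. -/
def IsTrace {n : ℕ} {Ω : Set (Rn n)} (u : V Ω) (g : Lp ℝ 2 (surfaceMeasure Ω)) : Prop :=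
  ∃ φ : ℕ → Rn n → ℝ, (∀ k, ContDiff ℝ 1 (φ k) ∧ HasCompactSupport (φ k)) ∧
    Tendsto (fun k => eLpNorm (fun x => φ k x - u.onDomain x) 2 (volume.restrict Ω)) atTop (𝓝 0) ∧
    Tendsto (fun k => eLpNorm (fun x => gradient (φ k) x - u.grad x) 2 (volume.restrict Ω))
      atTop (𝓝 0) ∧
    Tendsto (fun k => eLpNorm (fun x => φ k x - g x) 2 (surfaceMeasure Ω)) atTop (𝓝 0)

open Classical in
/-- The trace operator `V → L²(∂Ω)`. For bounded `Ω` with `C¹` boundary, the trace exists and is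
unique. -/
def trace {n : ℕ} {Ω : Set (Rn n)} (u : V Ω) : Lp ℝ 2 (surfaceMeasure Ω) :=
  if hu : ∃ g, IsTrace u g then hu.choose else 0

/-- The Bochner space `L²(0,T;X)`. -/
abbrev L2Time (T : ℝ) (X : Type) [NormedAddCommGroup X] : Type :=
  Lp X 2 ((volume : Measure ℝ).restrict (Ioo 0 T))

/-- `f'` is the weak derivative of `f` on `(0,T)`. -/
def HasWeakTimeDeriv {X : Type} [NormedAddCommGroup X] [NormedSpace ℝ X] (T : ℝ)
    (f f' : ℝ → X) : Prop :=
  ∀ φ : ℝ → ℝ, ContDiff ℝ ∞ φ → HasCompactSupport φ → tsupport φ ⊆ Ioo 0 T →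
    ∫ t in Ioo 0 T, deriv φ t • f t = - ∫ t in Ioo 0 T, φ t • f' t

/-- The trace of `f` at time `T` is zero: `f` has a representative that is continuous on `[0,T]`
and vanishes at `T`. -/
def VanishesAt {X : Type} [NormedAddCommGroup X] (T : ℝ) (f : ℝ → X) : Prop :=
  ∃ F : ℝ → X, ContinuousOn F (Icc 0 T) ∧ f =ᵐ[volume.restrict (Ioo 0 T)] F ∧ F T = 0

/-- The pairing `∫_{ℝⁿ} c⁻² f g dx` on `L²(ℝⁿ)`, by which `L²(ℝⁿ)` acts on square integrable
elements of `V`. -/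
def weightedPairing {n : ℕ} (c : Rn n → ℝ) (f g : L2Rn n) : ℝ :=
  ∫ x, (1 / c x ^ 2) * f x * g x

/-- `z ∈ L²(0,T;V)` is a weak solution of the backward transmission problem
`c⁻² z'' - Δz = 0` off `∂Ω`, `z(T) = z'(T) = 0`, `[z] = 0` and `[∂z/∂n] = h` on `∂Ω × (0,T)`.

Here `zf` is `z` as an element of `H¹(0,T;L²(ℝⁿ))`, `z'` its time derivative, and
`z'' ∈ L²(0,T;V')` is the time derivative of `z'`, where `z'(t) ∈ L²(ℝⁿ)` and `z''(t) ∈ V'` act on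
`w` as `∫ c⁻² z'(t) w dx` and `∫ c⁻² z''(t) w dx`. Since `c` does not depend on `t`, this says that
`z''` stands for `c⁻² z'' = (c⁻² z')'`. -/
def IsWeakSolution {n : ℕ} (Ω : Set (Rn n)) (c : Rn n → ℝ) (T : ℝ) (h : ℝ → Rn n → ℝ)
    (z : L2Time T (V Ω)) : Prop :=
  ∃ (zf z' : L2Time T (L2Rn n)) (z'' : L2Time T (StrongDual ℝ (V Ω))),
    (∀ᵐ t ∂volume.restrict (Ioo 0 T), (z t).IsFunction (zf t)) ∧
    HasWeakTimeDeriv T zf z' ∧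
    (∀ (w : V Ω) (f : L2Rn n), w.IsFunction f →
      HasWeakTimeDeriv T (fun t => weightedPairing c (z' t) f) (fun t => z'' t w)) ∧
    VanishesAt T zf ∧
    (∀ (w : V Ω) (f : L2Rn n), w.IsFunction f →
      VanishesAt T (fun t => weightedPairing c (z' t) f)) ∧
    ∀ v : L2Time T (V Ω),
      IntegrableOn (fun t => ∫ x, h t x * trace (v t) x ∂surfaceMeasure Ω) (Ioo 0 T) ∧
      (∫ t in Ioo 0 T, z'' t (v t)) + ∫ t in Ioo 0 T, ∫ x, inner ℝ ((z t).grad x) ((v t).grad x) =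
        - ∫ t in Ioo 0 T, ∫ x, h t x * trace (v t) x ∂surfaceMeasure Ω

end WaveTransmission

end

/-! For two solutions with the same `h`, the jump terms cancel, and ζ = z₁ - z₂ solves the
homogeneous problem with zero data at T. The usual energy test function ζ' need not take values in
V, so the equation is tested with a primitive in time instead: v(t) = ∫_s^t ζ on (s,T), and v = 0
elsewhere. Since v' = ζ and v(s) = 0, the Dirichlet term integrates to half the square of v(T). In
the other term, integration by parts moves the primitive from ζ to c⁻²ζ''; the zero data at T turn
it into half of ∫ c⁻² ζ(s)². Two nonnegative numbers have sum zero, so ζ(s) = 0 for almost every s.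
This is `ae_eq_zero_of_energy`.

The functions of time are only integrable, so the calculus is done with Fubini
(`integral_bilin_primitive_swap`) and du Bois-Reymond. A further difficulty is that the equation for
c⁻²z' holds for each fixed w outside a null set depending on w, while it is needed at w = ζ(t).
Separability gives one null set for all w (`ae_forall_pairing_eq`). -/

namespace WaveTransmission

/-! ### Bilinear integration by parts for primitives of integrable functions. -/

section Primitive

theorem intervalIntegrable_bilin_primitive {X Y Z : Type*} [NormedAddCommGroup X]
    [NormedSpace ℝ X] [NormedAddCommGroup Y] [NormedSpace ℝ Y] [NormedAddCommGroup Z]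
    [NormedSpace ℝ Z] (B : X →L[ℝ] Y →L[ℝ] Z) {a : ℝ → X} {b : ℝ → Y}
    {s T : ℝ} (ha : IntervalIntegrable a volume s T) (hb : IntervalIntegrable b volume s T) :
    IntervalIntegrable (fun t => B (a t) (∫ τ in s..t, b τ)) volume s T := by
  have hc : ContinuousOn (fun t => ∫ τ in s..t, b τ) (uIcc s T) :=
    intervalIntegral.continuousOn_primitive_interval' hb left_mem_uIcc
  obtain ⟨C, hC⟩ := isCompact_uIcc.exists_bound_of_continuousOn hc
  rw [intervalIntegrable_iff] at ha ⊢
  refine Integrable.mono' (ha.norm.const_mul (‖B‖ * C)) ?_ ?_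
  · exact B.aestronglyMeasurable_comp₂ ha.aestronglyMeasurable
      ((hc.mono uIoc_subset_uIcc).aestronglyMeasurable measurableSet_uIoc)
  · filter_upwards [ae_restrict_mem measurableSet_uIoc] with t ht
    calc _ ≤ ‖B‖ * ‖a t‖ * ‖∫ τ in s..t, b τ‖ := B.le_opNorm₂ _ _
      _ ≤ ‖B‖ * ‖a t‖ * C := by gcongr; exact hC t (uIoc_subset_uIcc ht)
      _ = _ := by ring

variable {X Y Z : Type*} [NormedAddCommGroup X] [NormedSpace ℝ X] [CompleteSpace X]
  [NormedAddCommGroup Y] [NormedSpace ℝ Y] [CompleteSpace Y]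
  [NormedAddCommGroup Z] [NormedSpace ℝ Z] [CompleteSpace Z]

/-- Integration by parts for primitives under a bounded bilinear map. -/
theorem integral_bilin_primitive_swap (B : X →L[ℝ] Y →L[ℝ] Z) {a : ℝ → X} {b : ℝ → Y} {s T : ℝ}
    (hsT : s ≤ T) (ha : IntervalIntegrable a volume s T) (hb : IntervalIntegrable b volume s T) :
    ∫ t in s..T, B (a t) (∫ τ in s..t, b τ) = ∫ τ in s..T, B (∫ t in τ..T, a t) (b τ) := by
  rw [intervalIntegrable_iff_integrableOn_Ioc_of_le hsT] at ha hb
  set μ := (volume : Measure ℝ).restrict (Ioc s T) with hμ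
  -- The integrand cut to the triangle τ ≤ t; the two sides are its two iterated integrals.
  set F : ℝ → ℝ → Z := fun t τ => {p : ℝ × ℝ | p.2 ≤ p.1}.indicator (fun p => B (a p.1) (b p.2)) (t, τ)
    with hF
  have hint : Integrable (Function.uncurry F) (μ.prod μ) := by
    have h1 : Integrable (fun p : ℝ × ℝ => B (a p.1) (b p.2)) (μ.prod μ) :=
      Integrable.op_fst_snd (op := fun x y => B x y) (by fun_prop)
        ⟨‖B‖, fun x y => B.le_opNorm₂ x y⟩ ha hb
    exact h1.indicator (measurableSet_le measurable_snd measurable_fst)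
  have h := integral_integral_swap hint
  rw [intervalIntegral.integral_of_le hsT, intervalIntegral.integral_of_le hsT]
  have hl : ∀ t ∈ Ioc s T, B (a t) (∫ τ in s..t, b τ) = ∫ τ, F t τ ∂μ := by
    intro t ht
    rw [intervalIntegral.integral_of_le ht.1.le, ← ContinuousLinearMap.integral_comp_comm]
    · have : F t = (Iic t).indicator (fun τ => B (a t) (b τ)) := by
        ext τ; simp [hF, indicator]
      rw [this, integral_indicator measurableSet_Iic, hμ, Measure.restrict_restrict measurableSet_Iic]
      congr 2
      ext τ; simp only [mem_Ioc, mem_inter_iff, mem_Iic]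
      exact ⟨fun h => ⟨h.2, h.1, h.2.trans ht.2⟩, fun h => ⟨h.2.1, h.1⟩⟩
    · exact hb.mono_set (Ioc_subset_Ioc_right ht.2)
  have hr : ∀ τ ∈ Ioc s T, B (∫ t in τ..T, a t) (b τ) = ∫ t, F t τ ∂μ := by
    intro τ hτ
    have e : (fun t => F t τ) = (Ici τ).indicator (fun t => B.flip (b τ) (a t)) := by
      ext t; simp [hF, indicator]
    rw [intervalIntegral.integral_of_le hτ.2, ← B.flip_apply, ← ContinuousLinearMap.integral_comp_comm]
    · rw [e, integral_indicator measurableSet_Ici, hμ, Measure.restrict_restrict measurableSet_Ici,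
        ← integral_Icc_eq_integral_Ioc]
      congr 2
      ext t; simp only [mem_Ioc, mem_inter_iff, mem_Ici, mem_Icc]
      exact ⟨fun h => ⟨h.1, hτ.1.trans_le h.1, h.2⟩, fun h => ⟨h.1, h.2.2⟩⟩
    · exact ha.mono_set (Ioc_subset_Ioc_left hτ.1.le)
  rw [setIntegral_congr_fun measurableSet_Ioc hl, setIntegral_congr_fun measurableSet_Ioc hr]
  exact h

/-- The integral of `B(g, ∫ g)` is half the square of `∫ g`, for `B` symmetric. -/
theorem integral_bilin_primitive_self (B : X →L[ℝ] X →L[ℝ] ℝ) (hB : ∀ x y, B x y = B y x)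
    {g : ℝ → X} {s T : ℝ} (hsT : s ≤ T) (hg : IntervalIntegrable g volume s T) :
    ∫ t in s..T, B (g t) (∫ τ in s..t, g τ) = 1 / 2 * B (∫ t in s..T, g t) (∫ t in s..T, g t) := by
  have h1 := integral_bilin_primitive_swap B hsT hg hg
  -- With G = ∫_s^T g, writing ∫_t^T g = G - ∫_s^t g shows that the swapped integral is B(G,G) minus
  -- the original one. As the two agree by `h1`, each is half of B(G,G).
  have h2 : ∫ τ in s..T, B (∫ t in τ..T, g t) (g τ) =
      B (∫ t in s..T, g t) (∫ t in s..T, g t) - ∫ t in s..T, B (g t) (∫ τ in s..t, g τ) := by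
    rw [← ContinuousLinearMap.intervalIntegral_comp_comm _ hg, ← intervalIntegral.integral_sub]
    · refine intervalIntegral.integral_congr fun t ht => ?_
      have hst : IntervalIntegrable g volume s t :=
        hg.mono_set (uIcc_subset_uIcc left_mem_uIcc ht)
      have htT : IntervalIntegrable g volume t T :=
        hg.mono_set (uIcc_subset_uIcc ht right_mem_uIcc)
      rw [← intervalIntegral.integral_add_adjacent_intervals hst htT, map_add,
        add_apply, hB (g t)]
      ring
    · rw [intervalIntegrable_iff] at hg ⊢
      exact (B _).integrable_comp hg
    · exact intervalIntegrable_bilin_primitive B hg hg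
  linarith

end Primitive

/-! ### Weak derivatives in time and their primitives. -/

section WeakDerivative

variable {X : Type} [NormedAddCommGroup X] [NormedSpace ℝ X] [CompleteSpace X]

/-- A smooth function with mean zero and compact support in an interval is the derivative of such
a function. -/
theorem exists_test_primitive {T : ℝ} {k : ℝ → ℝ} (hk : ContDiff ℝ ∞ k)
    (hkc : HasCompactSupport k) (hks : tsupport k ⊆ Ioo 0 T) (hT : 0 < T)
    (h0 : ∫ x in Ioo 0 T, k x = 0) :
    ∃ φ : ℝ → ℝ, ContDiff ℝ ∞ φ ∧ HasCompactSupport φ ∧ tsupport φ ⊆ Ioo 0 T ∧ deriv φ = k := by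
  obtain ⟨a, b, hab, hb, hK⟩ : ∃ a b, 0 < a ∧ b < T ∧ tsupport k ⊆ Icc a b := by
    rcases (tsupport k).eq_empty_or_nonempty with he | hne
    · exact ⟨T / 2, T / 2, by linarith, by linarith, by simp [he]⟩
    · have hc : IsCompact (tsupport k) := hkc
      exact ⟨sInf (tsupport k), sSup (tsupport k), (hks (hc.sInf_mem hne)).1,
        (hks (hc.sSup_mem hne)).2, fun x hx =>
          ⟨csInf_le hc.bddBelow hx, le_csSup hc.bddAbove hx⟩⟩
  have hz : ∀ x, x ∉ Icc a b → k x = 0 := fun x hx =>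
    image_eq_zero_of_notMem_tsupport fun h => hx (hK h)
  have hd : ∀ x, HasDerivAt (fun x => ∫ t in (0 : ℝ)..x, k t) (k x) x := fun x =>
    intervalIntegral.integral_hasDerivAt_right (hk.continuous.intervalIntegrable _ _)
      (hk.continuous.stronglyMeasurableAtFilter _ _) hk.continuous.continuousAt
  have hderiv : deriv (fun x => ∫ t in (0 : ℝ)..x, k t) = k := funext fun x => (hd x).deriv
  have hsupp : Function.support (fun x => ∫ t in (0 : ℝ)..x, k t) ⊆ Icc a b := by
    intro x hx
    by_contra hxab
    refine hx ?_
    rw [mem_Icc, not_and_or, not_le, not_le] at hxab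
    rcases hxab with h | h
    · refine (intervalIntegral.integral_congr (g := fun _ => (0 : ℝ)) fun t ht => ?_).trans (by simp)
      refine hz t fun htm => ?_
      have := ht.2
      have := htm.1
      have : max 0 x < a := max_lt hab h
      linarith
    -- To the right of b the primitive vanishes because k has mean zero.
    · have e : ∫ t in (0 : ℝ)..T, k t = 0 := by
        rw [intervalIntegral.integral_of_le hT.le, integral_Ioc_eq_integral_Ioo, h0]
      have e2 : ∫ t in x..T, k t = 0 := by
        refine (intervalIntegral.integral_congr (g := fun _ => (0 : ℝ)) fun t ht => ?_).trans
          (by simp)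
        refine hz t fun htm => ?_
        have := ht.1
        have := htm.2
        have : b < min x T := lt_min h hb
        linarith
      have := intervalIntegral.integral_add_adjacent_intervals
        (hk.continuous.intervalIntegrable (μ := volume) 0 x)
        (hk.continuous.intervalIntegrable x T)
      simp only
      linarith
  have hts := closure_minimal hsupp isClosed_Icc
  refine ⟨_, ?_, HasCompactSupport.of_support_subset_isCompact isCompact_Icc hsupp,
    hts.trans (Icc_subset_Ioo hab hb), hderiv⟩
  rw [contDiff_infty_iff_deriv, hderiv]
  exact ⟨fun x => (hd x).differentiableAt, hk⟩

/-- The lemma of du Bois-Reymond. -/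
theorem exists_ae_eq_const_of_integral_deriv_smul {T : ℝ} (hT : 0 < T) {g : ℝ → X}
    (hg : IntegrableOn g (Ioo 0 T))
    (h : ∀ φ : ℝ → ℝ, ContDiff ℝ ∞ φ → HasCompactSupport φ → tsupport φ ⊆ Ioo 0 T →
      ∫ t in Ioo 0 T, deriv φ t • g t = 0) :
    ∃ C : X, ∀ᵐ t ∂volume.restrict (Ioo 0 T), g t = C := by
  let bump : ContDiffBump (T / 2) := ⟨T / 8, T / 4, by linarith, by linarith⟩
  set η : ℝ → ℝ := bump.normed volume with hη
  have hηs : tsupport η ⊆ Ioo 0 T := by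
    rw [hη, bump.tsupport_normed_eq, Real.closedBall_eq_Icc]
    exact Icc_subset_Ioo (by change 0 < T / 2 - T / 4; linarith) (by change T / 2 + T / 4 < T; linarith)
  have hηd : ContDiff ℝ ∞ η := bump.contDiff_normed
  have hηc : HasCompactSupport η := bump.hasCompactSupport_normed
  have hint : ∀ {ψ : ℝ → ℝ}, ContDiff ℝ ∞ ψ → HasCompactSupport ψ →
      IntegrableOn (fun t => ψ t • g t) (Ioo 0 T) := by
    intro ψ hψ hψc
    obtain ⟨M, hM⟩ := hψc.exists_bound_of_continuous hψ.continuous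
    exact hg.bdd_smul M hψ.continuous.aestronglyMeasurable (Eventually.of_forall hM)
  have hη1 : ∫ t in Ioo 0 T, η t = 1 := by
    rw [setIntegral_eq_integral_of_forall_compl_eq_zero fun t ht =>
      image_eq_zero_of_notMem_tsupport fun h' => ht (hηs h')]
    exact bump.integral_normed
  refine ⟨∫ t in Ioo 0 T, η t • g t, ?_⟩
  rw [ae_restrict_iff' measurableSet_Ioo]
  set C := ∫ t in Ioo 0 T, η t • g t with hC
  have key : ∀ᵐ t, t ∈ Ioo 0 T → (fun t => g t - C) t = 0 := by
    have hgC : IntegrableOn (fun t => g t - C) (Ioo 0 T) :=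
      Integrable.sub hg (integrableOn_const (by simp))
    refine isOpen_Ioo.ae_eq_zero_of_integral_contDiff_smul_eq_zero hgC.locallyIntegrableOn ?_
    intro ψ hψ hψc hψs
    -- Since η has integral 1, ψ - I η has mean zero and is the derivative of a test function. Hence
    -- ∫ ψ g = I C = ∫ ψ C.
    set I := ∫ t in Ioo 0 T, ψ t with hI
    have hψi : IntegrableOn ψ (Ioo 0 T) :=
      (hψ.continuous.integrable_of_hasCompactSupport hψc).integrableOn
    have hηi : IntegrableOn η (Ioo 0 T) :=
      (hηd.continuous.integrable_of_hasCompactSupport hηc).integrableOn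
    have hc2 : HasCompactSupport fun t => I * η t := hηc.mul_left
    have hkc : HasCompactSupport (fun t => ψ t - I * η t) := hψc.sub hc2
    have hks : tsupport (fun t => ψ t - I * η t) ⊆ Ioo 0 T := by
      refine (tsupport_sub ψ fun t => I * η t).trans (union_subset hψs ?_)
      exact (closure_mono (Function.support_const_smul_subset I η)).trans hηs
    obtain ⟨φ, h1, h2, h3, h4⟩ := exists_test_primitive (T := T)
      (hψ.sub (contDiff_const.mul hηd)) hkc hks hT (by
        rw [integral_sub hψi (hηi.const_mul I), integral_const_mul, hη1, mul_one, sub_self])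
    have := h φ h1 h2 h3
    rw [h4] at this
    simp only [sub_smul, mul_smul] at this
    rw [integral_sub (hint hψ hψc) (g := fun t => I • η t • g t) ((hint hηd hηc).smul I),
      integral_smul, ← hC] at this
    rw [← setIntegral_eq_integral_of_forall_compl_eq_zero (s := Ioo 0 T) fun t ht => by
      rw [image_eq_zero_of_notMem_tsupport fun h' => ht (hψs h'), zero_smul]]
    simp only [smul_sub]
    rw [integral_sub (hint hψ hψc) (hψi.smul_const C), integral_smul_const, this]
  filter_upwards [key] with t ht hm
  exact sub_eq_zero.1 (ht hm)

/-- A function with a weak time derivative that vanishes at `T` is the integral of its derivative. -/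
theorem HasWeakTimeDeriv.ae_eq_neg_integral {T : ℝ} (hT : 0 < T) {f f' : ℝ → X}
    (hf : IntegrableOn f (Ioo 0 T)) (hf' : IntegrableOn f' (Ioo 0 T))
    (h : HasWeakTimeDeriv T f f') (h0 : VanishesAt T f) :
    ∀ᵐ t ∂volume.restrict (Ioo 0 T), f t = -∫ τ in t..T, f' τ := by
  have hI : IntegrableOn f' (uIcc 0 T) := by
    rwa [uIcc_of_le hT.le, integrableOn_Icc_iff_integrableOn_Ioo]
  have hII : IntervalIntegrable f' volume 0 T :=
    hI.intervalIntegrable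
  have hp : ContinuousOn (fun t => ∫ τ in t..T, f' τ) (Icc 0 T) := by
    simpa [uIcc_of_le hT.le] using intervalIntegral.continuousOn_primitive_interval_left hI
  have hpi : IntegrableOn (fun t => ∫ τ in t..T, f' τ) (Ioo 0 T) :=
    (hp.integrableOn_compact isCompact_Icc).mono_set Ioo_subset_Icc_self
  -- The sum of f and ∫_t^T f' has weak derivative zero, so it is constant. The swap is applied to
  -- φ', whose primitive from 0 is φ.
  obtain ⟨C, hC⟩ := exists_ae_eq_const_of_integral_deriv_smul hT (g := fun t => f t + ∫ τ in t..T, f' τ)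
    (hf.add hpi) (by
      intro φ h1 h2 h3
      have hφ' : Continuous (deriv φ) := h1.continuous_deriv (by simp)
      obtain ⟨M, hM⟩ := h2.deriv.exists_bound_of_continuous hφ'
      simp only [smul_add]
      rw [integral_add (f := fun t => deriv φ t • f t) (g := fun t => deriv φ t • ∫ τ in t..T, f' τ)
        (hf.bdd_smul M hφ'.aestronglyMeasurable (Eventually.of_forall hM))
        (hpi.bdd_smul M hφ'.aestronglyMeasurable (Eventually.of_forall hM)), h φ h1 h2 h3]
      have sw := integral_bilin_primitive_swap (ContinuousLinearMap.lsmul ℝ ℝ).flip hT.le hII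
        (hφ'.intervalIntegrable 0 T)
      simp only [ContinuousLinearMap.flip_apply, ContinuousLinearMap.lsmul_apply] at sw
      rw [← integral_Ioc_eq_integral_Ioo, ← integral_Ioc_eq_integral_Ioo,
        ← intervalIntegral.integral_of_le hT.le, ← intervalIntegral.integral_of_le hT.le, ← sw,
        neg_add_eq_zero]
      refine intervalIntegral.integral_congr fun t _ => ?_
      have hz : φ 0 = 0 := image_eq_zero_of_notMem_tsupport fun h' => lt_irrefl _ (h3 h').1
      rw [intervalIntegral.integral_deriv_eq_sub (fun x _ => h1.differentiable (by simp) x)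
        (hφ'.intervalIntegrable _ _), hz, sub_zero])
  obtain ⟨F, hF, hfF, hFT⟩ := h0
  -- With the continuous representative F the identity holds at every time, so it may be evaluated
  -- at T, where both terms vanish.
  have hEq : EqOn (fun t => F t + ∫ τ in t..T, f' τ) (fun _ => C) (Icc 0 T) := by
    refine Measure.eqOn_Icc_of_ae_eq volume hT.ne ?_ (hF.add hp) continuousOn_const
    rw [← restrict_Ioo_eq_restrict_Icc]
    filter_upwards [hC, hfF] with t h1 h2
    rw [← h1, h2]
  have hC0 : C = 0 := by
    have := hEq (right_mem_Icc.2 hT.le)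
    simpa [hFT] using this.symm
  filter_upwards [hC] with t ht
  rw [hC0] at ht
  exact eq_neg_of_add_eq_zero_left ht

end WeakDerivative

/-! ### The energy argument for abstract second order equations. -/

section Abstract

variable {E H : Type} [NormedAddCommGroup E] [NormedSpace ℝ E]
  [NormedAddCommGroup H] [NormedSpace ℝ H]

/-- An identity that holds for almost all times with each single test vector of a separable set
holds for almost all times with all of them. -/
theorem ae_forall_pairing_eq {α : Type*} [MeasurableSpace α] {μ : Measure α}
    {S : Set (E × H)} (hS : TopologicalSpace.IsSeparable S)
    (p : α → StrongDual ℝ H) (q : α → StrongDual ℝ E)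
    (h : ∀ w ∈ S, ∀ᵐ t ∂μ, p t w.2 = q t w.1) :
    ∀ᵐ t ∂μ, ∀ w ∈ S, p t w.2 = q t w.1 := by
  obtain ⟨D, hDS, hD, hSD⟩ := hS.exists_countable_dense_subset
  have h1 : ∀ᵐ t ∂μ, ∀ w ∈ D, p t w.2 = q t w.1 :=
    (ae_ball_iff hD).2 fun w hw => h w (hDS hw)
  filter_upwards [h1] with t ht w hw
  -- For fixed t both sides are continuous in w, so equality passes from the countable set D to its
  -- closure.
  have hcl : IsClosed {w : E × H | p t w.2 = q t w.1} :=
    isClosed_eq (by fun_prop) (by fun_prop)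
  exact closure_minimal ht hcl (hSD hw)

theorem integrable_dual_apply {α : Type*} [MeasurableSpace α] {μ : Measure α}
    {k : α → StrongDual ℝ E} {v : α → E} (hk : MemLp k 2 μ) (hv : MemLp v 2 μ) :
    Integrable (fun t => k t (v t)) μ :=
  memLp_one_iff_integrable.1 <|
    (ContinuousLinearMap.id ℝ (StrongDual ℝ E)).memLp_of_bilin 1 hk hv

/-- Integration in time of a weak derivative with values in a dual space, tested with a separable
set of vectors. -/
theorem ae_pairing_eq_neg_integral {T : ℝ} (hT : 0 < T) {S : Set (E × H)}
    (hS : TopologicalSpace.IsSeparable S) (P : H →L[ℝ] H →L[ℝ] ℝ)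
    {g : ℝ → H} {a : ℝ → StrongDual ℝ E}
    (hg : IntegrableOn g (Ioo 0 T)) (ha : IntegrableOn a (Ioo 0 T))
    (hd : ∀ w ∈ S, HasWeakTimeDeriv T (fun t => P (g t) w.2) (fun t => a t w.1))
    (h0 : ∀ w ∈ S, VanishesAt T (fun t => P (g t) w.2)) :
    ∀ᵐ t ∂volume.restrict (Ioo 0 T), ∀ w ∈ S, P (g t) w.2 = -(∫ τ in t..T, a τ) w.1 := by
  refine ae_forall_pairing_eq hS (fun t => P (g t)) (fun t => -∫ τ in t..T, a τ) fun w hw => ?_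
  have h1 := HasWeakTimeDeriv.ae_eq_neg_integral hT ((P.flip w.2).integrable_comp hg)
    ((ContinuousLinearMap.apply ℝ ℝ w.1).integrable_comp ha) (hd w hw) (h0 w hw)
  filter_upwards [h1, ae_restrict_mem measurableSet_Ioo] with t ht htm
  refine ht.trans ?_
  rw [neg_apply, neg_inj]
  refine (ContinuousLinearMap.apply ℝ ℝ w.1).intervalIntegral_comp_comm ?_
  rw [intervalIntegrable_iff_integrableOn_Ioo_of_le htm.2.le]
  exact ha.mono_set (Ioo_subset_Ioo_left htm.1.le)

/-- Energy identity: in an abstract second order equation `(Pf')' + B ζ = 0` with zero data at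
`T`, where `ζ` is `f` in the energy space, `f` vanishes. -/
theorem ae_eq_zero_of_energy [CompleteSpace E] [CompleteSpace H] {P : H →L[ℝ] H →L[ℝ] ℝ}
    (hPs : ∀ x y, P x y = P y x)
    (hP0 : ∀ x, 0 ≤ P x x) (hPd : ∀ x, P x x = 0 → x = 0)
    {B : E →L[ℝ] E →L[ℝ] ℝ} (hBs : ∀ x y, B x y = B y x) (hB0 : ∀ x, 0 ≤ B x x)
    {T : ℝ} {ζ : ℝ → E} {f g : ℝ → H} {a : ℝ → StrongDual ℝ E}
    (hζ : IntegrableOn ζ (Ioo 0 T)) (hg : IntegrableOn g (Ioo 0 T)) (ha : IntegrableOn a (Ioo 0 T))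
    (hf : ∀ᵐ t ∂volume.restrict (Ioo 0 T), f t = -∫ τ in t..T, g τ)
    (hPa : ∀ᵐ t ∂volume.restrict (Ioo 0 T), P (g t) (f t) = -(∫ τ in t..T, a τ) (ζ t))
    (heq : ∀ v : ℝ → E, MemLp v 2 (volume.restrict (Ioo 0 T)) →
      (∫ t in Ioo 0 T, a t (v t)) + ∫ t in Ioo 0 T, B (ζ t) (v t) = 0) :
    ∀ᵐ t ∂volume.restrict (Ioo 0 T), f t = 0 := by
  filter_upwards [hf, ae_restrict_mem measurableSet_Ioo] with s hs hsT
  have hle : s ≤ T := hsT.2.le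
  have hsub : Ioo s T ⊆ Ioo 0 T := Ioo_subset_Ioo_left hsT.1.le
  have hII : ∀ {F : Type} [NormedAddCommGroup F] {k : ℝ → F}, IntegrableOn k (Ioo 0 T) →
      IntervalIntegrable k volume s T := fun hk => by
    rw [intervalIntegrable_iff_integrableOn_Ioo_of_le hle]
    exact hk.mono_set hsub
  have hc : ContinuousOn (fun t => ∫ τ in s..t, ζ τ) (Icc s T) := by
    simpa [uIcc_of_le hle] using
      intervalIntegral.continuousOn_primitive_interval' (hII hζ) left_mem_uIcc
  obtain ⟨C, hC⟩ := isCompact_Icc.exists_bound_of_continuousOn hc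
  -- The primitive starts at s and is cut off before s, which localises the equation to (s,T); v is
  -- bounded, hence an admissible test function.
  set v : ℝ → E := (Ioo s T).indicator (fun t => ∫ τ in s..t, ζ τ) with hv
  have hC0 : 0 ≤ C := (norm_nonneg _).trans (hC s (left_mem_Icc.2 hle))
  have hvm : MemLp v 2 (volume.restrict (Ioo 0 T)) := by
    refine MemLp.of_bound (C := C) ?_ (Eventually.of_forall fun t => ?_)
    · rw [hv, aestronglyMeasurable_indicator_iff measurableSet_Ioo]
      exact ((hc.mono Ioo_subset_Icc_self).aestronglyMeasurable (μ := volume)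
        measurableSet_Ioo).mono_measure (Measure.restrict_mono_measure Measure.restrict_le_self _)
    · rw [hv]
      by_cases ht : t ∈ Ioo s T
      · rw [indicator_of_mem ht]
        exact hC t (Ioo_subset_Icc_self ht)
      · rwa [indicator_of_notMem ht, norm_zero]
  have hcut : ∀ L : ℝ → StrongDual ℝ E, ∫ t in Ioo 0 T, L t (v t) =
      ∫ t in s..T, L t (∫ τ in s..t, ζ τ) := by
    intro L
    have e : (fun t => L t (v t)) = (Ioo s T).indicator fun t => L t (∫ τ in s..t, ζ τ) := by
      ext t
      by_cases ht : t ∈ Ioo s T <;> simp [hv, ht]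
    rw [e, setIntegral_indicator measurableSet_Ioo, inter_eq_self_of_subset_right hsub,
      intervalIntegral.integral_of_le hle, integral_Ioc_eq_integral_Ioo]
  have h1 := heq v hvm
  rw [hcut a, hcut fun t => B (ζ t), integral_bilin_primitive_self B hBs hle (hII hζ)] at h1
  have h2 := integral_bilin_primitive_swap (ContinuousLinearMap.id ℝ (StrongDual ℝ E)) hle
    (hII ha) (hII hζ)
  simp only [ContinuousLinearMap.id_apply] at h2
  -- The equation integrated from t to T, paired with ζ(t), replaces a by g; the E-valued ζ becomes
  -- the H-valued f = -∫_t^T g.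
  have h3 : ∫ τ in s..T, (∫ t in τ..T, a t) (ζ τ) = ∫ τ in s..T, P (∫ t in τ..T, g t) (g τ) := by
    rw [intervalIntegral.integral_of_le hle, intervalIntegral.integral_of_le hle,
      integral_Ioc_eq_integral_Ioo, integral_Ioc_eq_integral_Ioo]
    refine integral_congr_ae ?_
    filter_upwards [ae_restrict_of_ae_restrict_of_subset hsub hf,
      ae_restrict_of_ae_restrict_of_subset hsub hPa] with t ht1 ht2
    have ht3 : ∫ τ in t..T, g τ = -f t := by rw [ht1, neg_neg]
    rw [hPs, ht3, map_neg, ht2, neg_neg]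
  -- Now `h1` says that half the P-square of ∫_s^T g = -f(s) and half the B-square of ∫_s^T ζ add up
  -- to zero.
  rw [h2, h3, ← integral_bilin_primitive_swap P hle (hII hg) (hII hg),
    integral_bilin_primitive_self P hPs hle (hII hg)] at h1
  have h4 := hP0 (∫ t in s..T, g t)
  have h5 := hB0 (∫ t in s..T, ζ t)
  rw [hs, hPd (∫ t in s..T, g t) (by linarith), neg_zero]

end Abstract

/-! ### The space V, the Dirichlet form and the weighted pairing. -/

section Concrete

variable {n : ℕ} {Ω : Set (Rn n)}

theorem HasWeakGradient.ae_unique {f : Rn n → ℝ} {G₁ G₂ : Lp (Rn n) 2 (volume : Measure (Rn n))}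
    (h₁ : HasWeakGradient f G₁) (h₂ : HasWeakGradient f G₂) : G₁ = G₂ := by
  have l₁ := (Lp.memLp G₁).locallyIntegrable one_le_two
  have l₂ := (Lp.memLp G₂).locallyIntegrable one_le_two
  have h := ae_eq_zero_of_integral_contDiff_smul_eq_zero (l₁.sub l₂) fun ψ hψ hψc => by
    simp only [Pi.sub_apply, smul_sub]
    rw [integral_sub (l₁.integrable_smul_left_of_hasCompactSupport hψ.continuous hψc)
      (l₂.integrable_smul_left_of_hasCompactSupport hψ.continuous hψc), sub_eq_zero]
    exact neg_injective ((h₁ ψ hψ hψc).symm.trans (h₂ ψ hψ hψc))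
  refine Lp.ext ?_
  filter_upwards [h] with x hx
  exact sub_eq_zero.1 hx

/-- Carries the conclusion from L²(ℝⁿ) back to V: f fixes both its restriction to Ω and its weak
gradient. -/
theorem V.IsFunction.unique {u₁ u₂ : V Ω} {f : L2Rn n} (h₁ : u₁.IsFunction f)
    (h₂ : u₂.IsFunction f) : u₁ = u₂ := by
  have e₁ : u₁.onDomain = u₂.onDomain := Lp.ext (h₁.1.trans h₂.1.symm)
  have e₂ : u₁.grad = u₂.grad := h₁.2.ae_unique h₂.2
  refine Subtype.ext (WithLp.ofLp_injective 2 (Prod.ext e₁ e₂))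

/-- The Dirichlet form `∫ ∇u·∇w` on `V`. -/
theorem exists_dirichletForm (Ω : Set (Rn n)) : ∃ B : V Ω →L[ℝ] V Ω →L[ℝ] ℝ,
    ∀ u w, B u w = ∫ x, inner ℝ (u.grad x) (w.grad x) := by
  let L : V Ω →L[ℝ] Lp (Rn n) 2 (volume : Measure (Rn n)) :=
    (WithLp.sndL 2 ℝ _ _).comp (VSubmodule Ω).subtypeL
  refine ⟨(isBoundedBilinearMap_inner (𝕜 := ℝ)
    (E := Lp (Rn n) 2 (volume : Measure (Rn n)))).toContinuousLinearMap.bilinearComp L L,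
    fun u w => ?_⟩
  exact L2.inner_def (𝕜 := ℝ) u.grad w.grad

/-- Multiplication by c⁻² ∈ L^∞ is bounded on L² by Hölder, and the inner product with the result is
the pairing. It is definite because c⁻² vanishes nowhere. -/
theorem exists_weightedPairing {c : Rn n → ℝ} {M : ℝ}
    (hm : AEStronglyMeasurable (fun x => 1 / c x ^ 2) (volume : Measure (Rn n)))
    (hM : ∀ x, ‖1 / c x ^ 2‖ ≤ M) (hc : ∀ x, c x ≠ 0) :
    ∃ P : L2Rn n →L[ℝ] L2Rn n →L[ℝ] ℝ, (∀ f g, P f g = weightedPairing c f g) ∧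
      (∀ f g, P f g = P g f) ∧ (∀ f, 0 ≤ P f f) ∧ ∀ f, P f f = 0 → f = 0 := by
  have hw : MemLp (fun x => 1 / c x ^ 2) ⊤ (volume : Measure (Rn n)) :=
    memLp_top_of_bound hm M (Eventually.of_forall hM)
  let K : L2Rn n →L[ℝ] L2Rn n :=
    (ContinuousLinearMap.lsmul ℝ ℝ).holderL (volume : Measure (Rn n)) ⊤ 2 2 hw.toLp
  have hP : ∀ f g : L2Rn n, inner ℝ (K f) g = weightedPairing c f g := by
    intro f g
    rw [L2.inner_def]
    refine integral_congr_ae ?_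
    filter_upwards [(ContinuousLinearMap.lsmul ℝ ℝ).coeFn_holder (r := 2) (hw.toLp) f,
      hw.coeFn_toLp] with x h1 h2
    have : (K f) x = 1 / c x ^ 2 * f x := by
      rw [← h2]; exact h1
    rw [this, real_inner_comm]
    simp
  have hpos : ∀ f : L2Rn n, ∀ x, 0 ≤ 1 / c x ^ 2 * f x * f x := fun f x => by
    rw [mul_assoc]; exact mul_nonneg (by positivity) (mul_self_nonneg _)
  refine ⟨(isBoundedBilinearMap_inner (𝕜 := ℝ)
    (E := L2Rn n)).toContinuousLinearMap.comp K, hP, fun f g => ?_, fun f => ?_, fun f h => ?_⟩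
  · refine (hP f g).trans (.trans ?_ (hP g f).symm)
    exact integral_congr_ae (Eventually.of_forall fun x => mul_right_comm _ _ _)
  · exact (integral_nonneg (hpos f)).trans_eq (hP f f).symm
  · have h0 : ∫ x, 1 / c x ^ 2 * f x * f x = 0 := (hP f f).symm.trans h
    have hi : Integrable fun x => 1 / c x ^ 2 * f x * f x := by
      simp only [mul_assoc]
      exact ((Lp.memLp f).integrable_mul (Lp.memLp f)).bdd_mul hm (Eventually.of_forall hM)
    rw [integral_eq_zero_iff_of_nonneg (hpos f) hi] at h0
    rw [Lp.eq_zero_iff_ae_eq_zero]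
    filter_upwards [h0] with x hx
    simpa [hc x] using hx

theorem measurable_of_continuousOn_closure {c : Rn n → ℝ} (hc : ContinuousOn c (closure Ω))
    (hc_ext : ∀ x ∉ closure Ω, c x = 1) : Measurable c := by
  classical
  have e : c = (closure Ω).piecewise c fun _ => 1 := by
    ext x
    by_cases hx : x ∈ closure Ω
    · simp [hx]
    · simp [hx, hc_ext x hx]
  rw [e]
  exact hc.measurable_piecewise continuousOn_const isClosed_closure.measurableSet

theorem isSeparable_pairs (S : Set (V Ω × L2Rn n)) : TopologicalSpace.IsSeparable S := by
  have : Fact ((2 : ENNReal) ≠ ⊤) := ⟨ENNReal.ofNat_ne_top⟩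
  have : SecondCountableTopology (Lp ℝ 2 ((volume : Measure (Rn n)).restrict Ω)) :=
    Lp.SecondCountableTopology
  have : SecondCountableTopology (Lp (Rn n) 2 (volume : Measure (Rn n))) :=
    Lp.SecondCountableTopology
  have : SecondCountableTopology (PairSpace Ω) :=
    (WithLp.homeomorphProd 2 _ _).secondCountableTopology
  have : SecondCountableTopology (V Ω) := inferInstanceAs (SecondCountableTopology (Subtype _))
  have : SecondCountableTopology (L2Rn n) := Lp.SecondCountableTopology
  exact TopologicalSpace.IsSeparable.of_separableSpace S

end Concrete

end WaveTransmission

/-! ### Uniqueness for the transmission problem. -/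

set_option maxHeartbeats 2000000 in
open WaveTransmission in
/-- Uniqueness of weak solutions for any coefficient with `c⁻²` bounded and measurable. -/
theorem weakSolution_unique {n : ℕ} {Ω : Set (Rn n)} {c : Rn n → ℝ} {M T : ℝ} (hT : 0 < T)
    (hm : AEStronglyMeasurable (fun x => 1 / c x ^ 2) (volume : Measure (Rn n)))
    (hM : ∀ x, ‖1 / c x ^ 2‖ ≤ M) (hc : ∀ x, c x ≠ 0) {h : ℝ → Rn n → ℝ}
    {z₁ z₂ : L2Time T (V Ω)} (hz₁ : IsWeakSolution Ω c T h z₁) (hz₂ : IsWeakSolution Ω c T h z₂) :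
    z₁ = z₂ := by
  have : CompleteSpace (V Ω) :=
    (Submodule.isClosed_topologicalClosure _).completeSpace_coe
  obtain ⟨P, hP, hPs, hP0, hPd⟩ := exists_weightedPairing hm hM hc
  obtain ⟨B, hB⟩ := exists_dirichletForm Ω
  obtain ⟨f₁, g₁, a₁, hf₁, hfg₁, hga₁, hf0₁, hg0₁, heq₁⟩ := hz₁
  obtain ⟨f₂, g₂, a₂, hf₂, hfg₂, hga₂, hf0₂, hg0₂, heq₂⟩ := hz₂
  have hint : ∀ {X : Type} [NormedAddCommGroup X] (k : L2Time T X), IntegrableOn k (Ioo 0 T) :=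
    fun k => (Lp.memLp k).integrable one_le_two
  have hI : ∀ {X : Type} [NormedAddCommGroup X] (k : L2Time T X), ∀ t ∈ Ioo 0 T,
      IntervalIntegrable k volume t T := fun k t ht => by
    rw [intervalIntegrable_iff_integrableOn_Ioo_of_le ht.2.le]
    exact (hint k).mono_set (Ioo_subset_Ioo_left ht.1.le)
  have hS := isSeparable_pairs {p : V Ω × L2Rn n | p.1.IsFunction p.2}
  simp only [← hP] at hga₁ hg0₁ hga₂ hg0₂
  have hp₁ := ae_pairing_eq_neg_integral hT hS P (hint g₁) (hint a₁)
    (fun w hw => hga₁ w.1 w.2 hw) fun w hw => hg0₁ w.1 w.2 hw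
  have hp₂ := ae_pairing_eq_neg_integral hT hS P (hint g₂) (hint a₂)
    (fun w hw => hga₂ w.1 w.2 hw) fun w hw => hg0₂ w.1 w.2 hw
  have hF₁ := hfg₁.ae_eq_neg_integral hT (hint f₁) (hint g₁) hf0₁
  have hF₂ := hfg₂.ae_eq_neg_integral hT (hint f₂) (hint g₂) hf0₂
  have key := ae_eq_zero_of_energy hPs hP0 hPd (B := B)
    (fun x y => by rw [hB, hB]; simp only [real_inner_comm])
    (fun x => by rw [hB]; exact integral_nonneg fun _ => real_inner_self_nonneg)
    (T := T) (ζ := fun t => z₁ t - z₂ t) (f := fun t => f₁ t - f₂ t) (g := fun t => g₁ t - g₂ t)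
    (a := fun t => a₁ t - a₂ t) ((hint z₁).sub (hint z₂)) ((hint g₁).sub (hint g₂))
    ((hint a₁).sub (hint a₂)) (by
      filter_upwards [hF₁, hF₂, ae_restrict_mem measurableSet_Ioo] with t h1 h2 ht
      rw [h1, h2, intervalIntegral.integral_sub (hI g₁ t ht) (hI g₂ t ht)]
      abel) (by
      -- Each of the two equations is paired with both (z₁(t), f₁(t)) and (z₂(t), f₂(t));
      -- bilinearity then gives the identity for the differences.
      filter_upwards [hp₁, hp₂, hf₁, hf₂, ae_restrict_mem measurableSet_Ioo] with t h1 h2 h3 h4 ht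
      rw [intervalIntegral.integral_sub (hI a₁ t ht) (hI a₂ t ht)]
      simp only [map_sub, sub_apply, h1 (z₁ t, f₁ t) h3, h1 (z₂ t, f₂ t) h4,
        h2 (z₁ t, f₁ t) h3, h2 (z₂ t, f₂ t) h4]
      ring) (by
      intro v hv
      have e₁ := (heq₁ hv.toLp).2
      have e₂ := (heq₂ hv.toLp).2
      -- The right-hand sides are the same boundary integral, so h and the trace drop out.
      rw [← e₂] at e₁
      simp only [← hB] at e₁
      have hcongr : ∀ L : ℝ → StrongDual ℝ (V Ω),
          ∫ t in Ioo 0 T, L t ((hv.toLp : L2Time T (V Ω)) t) = ∫ t in Ioo 0 T, L t (v t) := fun L =>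
        integral_congr_ae (hv.coeFn_toLp.mono fun t ht => by simp only [ht])
      have hi : ∀ k : L2Time T (StrongDual ℝ (V Ω)), IntegrableOn (fun t => k t (v t)) (Ioo 0 T) :=
        fun k => integrable_dual_apply (Lp.memLp k) hv
      have hj : ∀ k : L2Time T (V Ω), IntegrableOn (fun t => B (k t) (v t)) (Ioo 0 T) :=
        fun k => memLp_one_iff_integrable.1 <| B.memLp_of_bilin 1 (Lp.memLp k) hv
      rw [hcongr a₁, hcongr a₂, hcongr fun t => B (z₁ t), hcongr fun t => B (z₂ t)] at e₁
      simp only [map_sub, sub_apply]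
      rw [integral_sub (hi a₁) (hi a₂), integral_sub (hj z₁) (hj z₂)]
      linarith)
  refine Lp.ext ?_
  filter_upwards [key, hf₁, hf₂] with t h0 h1 h2
  rw [sub_eq_zero.1 h0] at h1
  exact h1.unique h2

theorem mainTheorem5 (n : ℕ) (hn : 1 ≤ n) (Ω : Set (WaveTransmission.Rn n))
    (hΩ_open : IsOpen Ω) (hΩ_bdd : Bornology.IsBounded Ω) (hΩ_conn : IsConnected Ω)
    (hΩ_C1 : WaveTransmission.HasC1Boundary Ω)
    (c : WaveTransmission.Rn n → ℝ) (hc : WaveTransmission.IsC1UpToBoundary Ω c)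
    (cmin cmax : ℝ) (hcmin : 0 < cmin)
    (hc_bounds : ∀ x ∈ closure Ω, cmin ≤ c x ∧ c x ≤ cmax)
    (hc_ext : ∀ x ∉ closure Ω, c x = 1)
    (T : ℝ) (hT : 0 < T)
    (h : ℝ → WaveTransmission.Rn n → ℝ) (hh : WaveTransmission.SmoothOnLateral T Ω h)
    (z₁ z₂ : WaveTransmission.L2Time T (WaveTransmission.V Ω))
    (hz₁ : WaveTransmission.IsWeakSolution Ω c T h z₁)
    (hz₂ : WaveTransmission.IsWeakSolution Ω c T h z₂) :
    z₁ = z₂ := by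
  -- The 1 accounts for the exterior, where c = 1.
  have hpos : ∀ x, min cmin 1 ≤ c x := fun x => by
    by_cases hx : x ∈ closure Ω
    · exact (min_le_left _ _).trans (hc_bounds x hx).1
    · exact (min_le_right _ _).trans_eq (hc_ext x hx).symm
  have hm : 0 < min cmin 1 := lt_min hcmin one_pos
  refine weakSolution_unique (M := 1 / min cmin 1 ^ 2) hT
    (((WaveTransmission.measurable_of_continuousOn_closure hc.1 hc_ext).pow_const 2).const_div
      1).aestronglyMeasurable (fun x => ?_) (fun x => (hm.trans_le (hpos x)).ne') hz₁ hz₂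
  rw [Real.norm_of_nonneg (by positivity)]
  have := hpos x
  gcongr
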